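/- **Definitions.** A *commutative regular quasi-semiring* (cr-qsring) is an algebra $(R,+,\bullet,-,{}^{-1},\varepsilon)$ of signature $(2,2,1,1,0)$ such that $(R,+)$ and $(R,\bullet)$ are commutative regular semigroups with quasi-inverses $-x$ and $x^{-1}$ (that is, $x+(-x)+x=x$, $(-x)+x+(-x)=-x$, $x\bullet x^{-1}\bullet x=x$, $x^{-1}\bullet x\bullet x^{-1}=x^{-1}$) and, writing $e^+(x):=x+(-x)$, $E^+:=\{x : x+x=x\}$, $E^\bullet:=\{x : x\bullet x=x\}$ and $x\le y :\Leftrightarrow x=y+e^+(x)$ (a partial order): - $E^+\cap E^\bullet=\{\varepsilon\}$; - $x\bullet y+x\bullet z\le x\bullet(y+z)$ for all $x,y,z$; - $y\le z$ implies $x\bullet y\le x\bullet z$; - $-(x\bullet y)=x\bullet(-y)$; - $e^+(x+y)\le e^+(x\bullet y)$ for all $x,y\in E^\bullet$. Put $\Lambda:=E^+$ (an Abelian $l$-group under $\bullet$ with neutral element $\varepsilon$ and order $\le$), $\Lambda_+:=\{\alpha\in\Lambda:\varepsilon\le\alpha\}$ and $v(x):=\varepsilon\bullet x\in\Lambda$.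 The cr-qsring $R$ is *directed* if $\varepsilon\le x$ for all $x\in E^\bullet$. A directed $R$ is *superrigid* if the (injective) map $e^+|_{E^\bullet}:E^\bullet\to\Lambda_+$ is surjective; then $1_\alpha$ denotes the unique element of $E^\bullet$ with $e^+(1_\alpha)=\alpha$. A directed $R$ is *spherically complete* if for every $x\in R$ there is a map $\varphi:\Lambda\to R$ with $e^+(\varphi(\alpha))=\alpha$ for all $\alpha\in\Lambda$, $\varphi(\alpha)\le\varphi(\beta)$ whenever $\alpha\le\beta$, and $\varphi(e^+(x))=x$. For a superrigid directed cr-qsring $R$, let $B=B(R)$ be the set of all maps $\varphi:\Lambda_+\to R$ with $e^+(\varphi(\alpha))=\alpha$ for all $\alpha\in\Lambda_+$ and $\varphi(\alpha)\le\varphi(\beta)$ for $\alpha\le\beta$. It is a commutative unital ring with pointwise $+$ and $-$, zero $\alpha\mapsto\alpha$, unit $\alpha\mapsto 1_\alpha$, and product $$(\varphi\cdot\psi)(\alpha)=\varphi\bigl(\alpha\bullet v(\psi(\varepsilon))^{-1}\bigr)\bullet\psi\bigl(\alpha\bullet v(\varphi(\varepsilon))^{-1}\bigr)+\alpha .$$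 Let $w(\varphi):=v\circ\varphi$ and let $A:=\{\varphi\in B : w(\varphi)(\alpha)\ge\varepsilon\text{ for all }\alpha\in\Lambda_+\}=\{\varphi\in B:\varphi(\varepsilon)=\varepsilon\}$, a subring of $B$. The ring extension associated to $R$ is $A\subseteq B$. A commutative ring extension $A\subseteq B$ is a *Prüfer extension* if the invertible $A$-submodules of $B$ (the $A$-submodules $I\subseteq B$ with $IJ=A$ for some $A$-submodule $J\subseteq B$) are exactly the finitely generated $A$-submodules $I\subseteq B$ with $IB=B$. **Corollary 6.9.** Let $R$ be a superrigid directed cr-qsring. If $R$ is spherically complete, then $R$ is Prüfer, i.e. its associated ring extension $A\subseteq B$ is a Prüfer extension. -/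

import Mathlib

/-- The canonical relation attached to an addition and a quasi-inverse:
`x ≤ y` means `x = y + e⁺(x)`, where `e⁺(x) = x + (-x)`. -/
def crAddLE {R : Type*} [Add R] [Neg R] (x y : R) : Prop :=
  x = y + (x + -x)

/-- A commutative regular quasi-semiring (cr-qsring).  The multiplication `•` is written `*`. -/
class CRQSring (R : Type*) extends AddCommSemigroup R, CommSemigroup R, Neg R, Inv R where
  /-- the distinguished constant -/
  eps : R
  add_neg_add : ∀ x : R, x + -x + x = x
  neg_add_neg : ∀ x : R, -x + x + -x = -x
  mul_inv_mul : ∀ x : R, x * x⁻¹ * x = x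
  inv_mul_inv : ∀ x : R, x⁻¹ * x * x⁻¹ = x⁻¹
  idem_iff : ∀ x : R, (x + x = x ∧ x * x = x) ↔ x = eps
  quasi_distrib : ∀ x y z : R, crAddLE (x * y + x * z) (x * (y + z))
  mul_mono : ∀ x y z : R, crAddLE y z → crAddLE (x * y) (x * z)
  neg_mul_right : ∀ x y : R, -(x * y) = x * -y
  idem_add_le : ∀ x y : R, x * x = x → y * y = y →
    crAddLE ((x + y) + -(x + y)) (x * y + -(x * y))

namespace CRQSring

section Basic

variable {R : Type*} [CRQSring R]

/-- `e⁺(x) = x + (-x)`. -/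
def ep (x : R) : R := x + -x

/-- `e•(x) = x • x⁻¹`. -/
def eb (x : R) : R := x * x⁻¹

/-- The quasivaluation `v(x) = ε • x`. -/
def v (x : R) : R := eps * x

theorem ep_add_self (x : R) : ep x + x = x := add_neg_add x

theorem add_ep_self (x : R) : x + ep x = x := by rw [add_comm]; exact add_neg_add x

theorem ep_idem (x : R) : ep x + ep x = ep x := by
  unfold ep; rw [← add_assoc, add_neg_add]

theorem neg_unique {x y : R} (h1 : x + y + x = x) (h2 : y + x + y = y) : y = -x := by
  have a : y = y + x + -x + (x + y) := by
    calc y = y + x + y := h2.symm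
      _ = y + (x + -x + x) + y := by rw [add_neg_add]
      _ = _ := by ac_rfl
  have b : -x = -x + x + y + (x + -x) := by
    calc -x = -x + x + -x := (neg_add_neg x).symm
      _ = -x + (x + y + x) + -x := by rw [h1]
      _ = _ := by ac_rfl
  have c : y + x + -x + (x + y) = (x + y + x) + (-x + y) := by ac_rfl
  have d : -x + x + y + (x + -x) = (x + -x + x) + (-x + y) := by ac_rfl
  exact (a.trans c).trans (Eq.trans (by rw [h1, add_neg_add]) (b.trans d).symm)

theorem inv_unique {x y : R} (h1 : x * y * x = x) (h2 : y * x * y = y) : y = x⁻¹ := by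
  have a : y = (x * y * x) * (x⁻¹ * y) := by
    calc y = y * x * y := h2.symm
      _ = y * (x * x⁻¹ * x) * y := by rw [mul_inv_mul]
      _ = _ := by ac_rfl
  have b : x⁻¹ = (x * x⁻¹ * x) * (x⁻¹ * y) := by
    calc x⁻¹ = x⁻¹ * x * x⁻¹ := (inv_mul_inv x).symm
      _ = x⁻¹ * (x * y * x) * x⁻¹ := by rw [h1]
      _ = _ := by ac_rfl
  exact a.trans (Eq.trans (by rw [h1, mul_inv_mul]) b.symm)

theorem neg_idem {f : R} (hf : f + f = f) : -f = f := (neg_unique (by simp [hf]) (by simp [hf])).symm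

theorem ep_of_idem {f : R} (hf : f + f = f) : ep f = f := by rw [ep, neg_idem hf, hf]

theorem neg_add' (x y : R) : -(x + y) = -x + -y := by
  symm; apply neg_unique
  · calc x + y + (-x + -y) + (x + y) = (x + -x + x) + (y + -y + y) := by ac_rfl
      _ = _ := by rw [add_neg_add, add_neg_add]
  · calc -x + -y + (x + y) + (-x + -y) = (-x + x + -x) + (-y + y + -y) := by ac_rfl
      _ = _ := by rw [neg_add_neg, neg_add_neg]

theorem ep_add (x y : R) : ep (x + y) = ep x + ep y := by
  unfold ep; rw [neg_add']; ac_rfl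

theorem ep_neg (x : R) : ep (-x) = ep x := by
  have : - -x = x := (neg_unique (neg_add_neg x) (add_neg_add x)).symm
  rw [ep, this, ep, add_comm]

/-- The canonical partial order `x ≤ y ↔ x = y + e⁺(x)`. -/
instance : PartialOrder R where
  le := crAddLE
  le_refl x := (add_ep_self x).symm
  le_trans x y z h1 h2 := by
    change x = y + ep x at h1
    change y = z + ep y at h2
    change x = z + ep x
    have e : ep x = ep y + ep x := by
      have := congrArg ep h1
      rwa [ep_add, ep_of_idem (ep_idem x)] at this
    calc x = z + ep y + ep x := by rw [← h2]; exact h1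
      _ = z + ep x := by rw [add_assoc, ← e]
  le_antisymm x y h1 h2 := by
    change x = y + ep x at h1
    change y = x + ep y at h2
    calc x = y + ep x := h1
      _ = x + ep x + ep y := by
          conv_lhs => rw [h2]
          ac_rfl
      _ = y := by rw [add_ep_self]; exact h2.symm

theorem le_def {x y : R} : x ≤ y ↔ x = y + ep x := Iff.rfl

/-- `Λ = E⁺`, the set of additive idempotents. -/
abbrev Lam (R : Type*) [CRQSring R] : Type _ := {f : R // f + f = f}

/-- `Λ₊`, the set of additive idempotents that are `≥ ε`. -/
abbrev LamPos (R : Type*) [CRQSring R] : Type _ := {f : R // f + f = f ∧ eps ≤ f}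

theorem le_of_add {x y f : R} (hf : f + f = f) (h : x = y + f) : x ≤ y := by
  rw [le_def]
  have e : ep x = ep y + f := by rw [h, ep_add, ep_of_idem hf]
  rw [e, ← add_assoc, add_ep_self, h]

theorem ep_le {x y : R} (h : x ≤ y) : ep x ≤ ep y := by
  refine le_of_add (ep_idem x) ?_
  have := congrArg ep (le_def.1 h)
  rwa [ep_add, ep_of_idem (ep_idem x)] at this

theorem add_mono {x y : R} (h : x ≤ y) (z : R) : x + z ≤ y + z := by
  refine le_of_add (ep_idem x) ?_
  conv_lhs => rw [le_def.1 h]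
  ac_rfl

theorem add_mono' {x y z t : R} (h : x ≤ y) (h' : z ≤ t) : x + z ≤ y + t := by
  refine (add_mono h z).trans ?_
  rw [add_comm y z, add_comm y t]
  exact add_mono h' y

theorem add_idem_le (x : R) {f : R} (hf : f + f = f) : x + f ≤ x := le_of_add hf rfl

theorem eq_of_le {x y : R} (h : x ≤ y) (h' : ep y ≤ ep x) : x = y := by
  have e := le_antisymm (ep_le h) h'
  rw [le_def.1 h, e, add_ep_self]

theorem idem_of_le {x f : R} (hf : f + f = f) (h : x ≤ f) : x + x = x := by
  have e : x + x = f + f + (ep x + ep x) := by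
    conv_lhs => rw [le_def.1 h]
    ac_rfl
  rw [e, hf, ep_idem, ← le_def.1 h]

theorem idem_add {f g : R} (hf : f + f = f) (hg : g + g = g) : (f + g) + (f + g) = f + g := by
  calc (f + g) + (f + g) = (f + f) + (g + g) := by ac_rfl
    _ = _ := by rw [hf, hg]

/-- On idempotents, `f ≤ g ↔ f + g = f`. -/
theorem add_of_le {f g : R} (hf : f + f = f) (h : f ≤ g) : f + g = f := by
  conv_rhs => rw [le_def.1 h, ep_of_idem hf]
  rw [add_comm]

theorem le_add {x f g : R} (hx : x + x = x) (h1 : x ≤ f) (h2 : x ≤ g) : x ≤ f + g := by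
  have := add_mono' h1 h2
  rwa [hx] at this

theorem mul_le (x : R) {y z : R} (h : y ≤ z) : x * y ≤ x * z := mul_mono x y z h

theorem mul_le' {x y z t : R} (h : x ≤ y) (h' : z ≤ t) : x * z ≤ y * t := by
  refine (mul_le x h').trans ?_
  rw [mul_comm x t, mul_comm y t]
  exact mul_le t h

theorem eps_add : (eps : R) + eps = eps := ((idem_iff (eps : R)).2 rfl).1

theorem eps_mul : (eps : R) * eps = eps := ((idem_iff (eps : R)).2 rfl).2

theorem inv_idem {f : R} (hf : f * f = f) : f⁻¹ = f := (inv_unique (by simp [hf]) (by simp [hf])).symm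

theorem eb_idem (x : R) : eb x * eb x = eb x := by
  unfold eb; rw [← mul_assoc, mul_inv_mul]

theorem mul_eb (x : R) : x * eb x = x := by rw [mul_comm]; exact mul_inv_mul x

theorem mul_idem_mul (x : R) {f : R} (hf : f + f = f) : x * f + x * f = x * f := by
  have h : x * f + x * f ≤ x * f := by
    have := quasi_distrib x f f
    rw [hf] at this; exact this
  have := le_def.1 h
  rw [ep_add, ep_idem, add_ep_self] at this
  exact this

theorem inv_mul' (x y : R) : (x * y)⁻¹ = x⁻¹ * y⁻¹ := by
  symm; apply inv_unique
  · calc x * y * (x⁻¹ * y⁻¹) * (x * y) = (x * x⁻¹ * x) * (y * y⁻¹ * y) := by ac_rfl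
      _ = _ := by rw [mul_inv_mul, mul_inv_mul]
  · calc x⁻¹ * y⁻¹ * (x * y) * (x⁻¹ * y⁻¹) = (x⁻¹ * x * x⁻¹) * (y⁻¹ * y * y⁻¹) := by ac_rfl
      _ = _ := by rw [inv_mul_inv, inv_mul_inv]

theorem eb_of_idem {f : R} (hf : f + f = f) : f * f⁻¹ = eps := by
  refine (idem_iff _).1 ⟨?_, eb_idem f⟩
  rw [mul_comm]; exact mul_idem_mul _ hf

theorem eps_mul_idem {f : R} (hf : f + f = f) : eps * f = f := by
  rw [← eb_of_idem hf, mul_inv_mul]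

theorem inv_add_idem {f : R} (hf : f + f = f) : f⁻¹ + f⁻¹ = f⁻¹ := by
  have : f⁻¹ = f⁻¹ * eps := by
    rw [← eb_of_idem hf, ← mul_assoc, inv_mul_inv]
  rw [this]; exact mul_idem_mul _ eps_add

theorem v_idem (x : R) : v x + v x = v x := by
  unfold v; rw [mul_comm]; exact mul_idem_mul _ eps_add

theorem v_of_idem {f : R} (hf : f + f = f) : v f = f := eps_mul_idem hf

theorem v_mul (x y : R) : v (x * y) = v x * v y := by
  unfold v
  calc eps * (x * y) = (eps * eps) * (x * y) := by rw [eps_mul]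
    _ = _ := by ac_rfl

theorem v_le {x y : R} (h : x ≤ y) : v x ≤ v y := mul_le _ h

theorem v_add (x y : R) : v x + v y ≤ v (x + y) := quasi_distrib _ _ _

theorem mul_idem_eq (x : R) {f : R} (hf : f + f = f) : x * f = v x * f := by
  unfold v
  calc x * f = x * (eps * f) := by rw [eps_mul_idem hf]
    _ = _ := by ac_rfl

theorem v_inv (x : R) : (v x)⁻¹ = v x⁻¹ := by
  unfold v; rw [inv_mul', inv_idem eps_mul]

theorem v_of_mul_idem {x : R} (hx : x * x = x) : v x = eps := by
  refine (idem_iff _).1 ⟨v_idem x, ?_⟩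
  rw [← v_mul, hx]

theorem neg_neg_mul (x : R) : -x * -x = x * x := by
  have nn : - -(x * x) = x * x := (neg_unique (neg_add_neg _) (add_neg_add _)).symm
  rw [← neg_mul_right, mul_comm, ← neg_mul_right, nn]

theorem v_neg (x : R) : v (-x) = v x := by
  unfold v; rw [← neg_mul_right]
  exact neg_idem (v_idem x)

theorem v_le_ep (x : R) : v x ≤ ep x := by
  have h := v_add x (-x)
  rw [v_neg, v_idem] at h
  change v x ≤ v (ep x) at h
  rwa [v_of_idem (ep_idem x)] at h

theorem ep_eq (x : R) : ep x = v x * ep (eb x) := by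
  apply le_antisymm
  · rw [← mul_idem_eq x (ep_idem _)]
    have h : x * eb x + x * -eb x ≤ x * (eb x + -eb x) := quasi_distrib _ _ _
    rw [← neg_mul_right, mul_eb] at h
    exact h
  · have h : x⁻¹ * x + x⁻¹ * -x ≤ x⁻¹ * (x + -x) := quasi_distrib _ _ _
    rw [← neg_mul_right, mul_comm x⁻¹ x] at h
    change ep (eb x) ≤ x⁻¹ * ep x at h
    refine (mul_le (v x) h).trans (le_of_eq ?_)
    rw [mul_idem_eq x⁻¹ (ep_idem x), ← v_inv, ← mul_assoc, eb_of_idem (v_idem x),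
      eps_mul_idem (ep_idem x)]

theorem ep_mul_of_mul_idem {x y : R} (hx : x * x = x) (hy : y * y = y) :
    ep (x * y) = ep x + ep y := by
  have key : ∀ {x y : R}, x * x = x → ep (x * y) ≤ ep y := by
    intro x y hx
    have h : x * y + x * -y ≤ x * (y + -y) := quasi_distrib _ _ _
    rw [← neg_mul_right] at h
    change ep (x * y) ≤ x * ep y at h
    rwa [mul_idem_eq x (ep_idem y), v_of_mul_idem hx, eps_mul_idem (ep_idem y)] at h
  apply le_antisymm
  · refine le_add (ep_idem _) ?_ (key hx)
    rw [mul_comm]; exact key hy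
  · rw [← ep_add]; exact idem_add_le x y hx hy

theorem mul_idem_add (x : R) {f g : R} (hf : f + f = f) (hg : g + g = g) :
    x * (f + g) = x * f + x * g := by
  apply le_antisymm
  · refine le_add (mul_idem_mul x (idem_add hf hg)) (mul_le x (add_idem_le f hg)) (mul_le x ?_)
    rw [add_comm]; exact add_idem_le g hf
  · exact quasi_distrib _ _ _

/-- Leibniz's rule. -/
theorem ep_mul (x y : R) : ep (x * y) = v x * ep y + v y * ep x := by
  have e : eb (x * y) = eb x * eb y := by unfold eb; rw [inv_mul']; ac_rfl
  rw [ep_eq (x * y), e, ep_mul_of_mul_idem (eb_idem x) (eb_idem y), v_mul,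
    mul_idem_add _ (ep_idem _) (ep_idem _), ep_eq y, ep_eq x, add_comm]
  congr 1 <;> ac_rfl

theorem neg_le {x y : R} (h : x ≤ y) : -x ≤ -y := by
  refine le_of_add (ep_idem x) ?_
  have := congrArg Neg.neg (le_def.1 h)
  rwa [neg_add', neg_idem (ep_idem x)] at this

/-- The binary meet for the canonical order. -/
def meet (x y : R) : R := x + v (x + -y)

theorem v_sub_comm (x y : R) : v (y + -x) = v (x + -y) := by
  have : - (x + -y) = y + -x := by
    have nn : - -y = y := (neg_unique (neg_add_neg _) (add_neg_add _)).symm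
    rw [neg_add', nn, add_comm]
  rw [← this, v_neg]

theorem v_sub_le (x y : R) : v (x + -y) ≤ ep x := by
  have h := v_le_ep (x + -y)
  rw [ep_add, ep_neg] at h
  exact h.trans (add_idem_le _ (ep_idem y))

theorem meet_le_left (x y : R) : meet x y ≤ x := add_idem_le x (v_idem _)

theorem ep_meet (x y : R) : ep (meet x y) = v (x + -y) := by
  unfold meet
  rw [ep_add, ep_of_idem (v_idem _), add_comm]
  exact add_of_le (v_idem _) (v_sub_le x y)

theorem le_meet {x y z : R} (h1 : z ≤ x) (h2 : z ≤ y) : z ≤ meet x y := by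
  have h := add_mono' h1 (neg_le h2)
  have h' := v_le h
  change v (ep z) ≤ _ at h'
  rw [v_of_idem (ep_idem z)] at h'
  have := add_mono' h1 h'
  rwa [add_ep_self] at this

end Basic

/-- A cr-qsring is directed when `ε ≤ x` for every multiplicative idempotent `x`. -/
class IsDirected (R : Type*) [CRQSring R] : Prop where
  eps_le : ∀ x : R, x * x = x → eps ≤ x

/-- A directed cr-qsring is superrigid when `e⁺ : E• → Λ₊` is surjective. -/
class IsSuperrigid (R : Type*) [CRQSring R] : Prop extends IsDirected R where
  exists_idem : ∀ α : LamPos R, ∃ x : R, x * x = x ∧ ep x = α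

/-- A directed cr-qsring is spherically complete when every `x` lies on a monotone section
`φ : Λ → R` of `e⁺`. -/
def IsSphericallyComplete (R : Type*) [CRQSring R] : Prop :=
  ∀ x : R, ∃ φ : Lam R → R,
    (∀ α, ep (φ α) = α) ∧ (∀ α β, α ≤ β → φ α ≤ φ β) ∧ φ ⟨ep x, ep_idem x⟩ = x

section Directed

variable {R : Type*} [CRQSring R] [IsDirected R]

theorem v_le_self (x : R) : v x ≤ x := by
  have h := mul_le x (IsDirected.eps_le (eb x) (eb_idem x))
  rw [mul_eb, mul_comm] at h
  exact h

theorem meet_comm (x y : R) : meet x y = meet y x := by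
  unfold meet
  have h := le_def.1 (v_le_self (x + -y))
  rw [ep_of_idem (v_idem _)] at h
  have hx := add_of_le (v_idem _) (v_sub_le x y)
  rw [v_sub_comm x y]
  symm
  calc y + v (x + -y) = y + (x + -y + v (x + -y)) := by rw [← h]
    _ = x + (v (x + -y) + (y + -y)) := by ac_rfl
    _ = x + v (x + -y) := by
        have h2 := v_sub_le y x
        rw [v_sub_comm] at h2
        have := add_of_le (v_idem _) h2
        unfold ep at this
        rw [this]

theorem meet_le_right (x y : R) : meet x y ≤ y := by rw [meet_comm]; exact meet_le_left y x

theorem mul_meet (x y z : R) : x * meet y z = meet (x * y) (x * z) := by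
  apply le_antisymm
  · exact le_meet (mul_le x (meet_le_left y z)) (mul_le x (meet_le_right y z))
  · unfold meet
    have h : x * y + x * -z ≤ x * (y + -z) := quasi_distrib _ _ _
    rw [neg_mul_right]
    have h2 := v_le h
    rw [v_mul, ← mul_idem_eq x (v_idem _)] at h2
    refine le_trans ?_ (quasi_distrib x y (v (y + -z)))
    exact add_mono' le_rfl h2

/-- Multiplicative idempotents: the product is the meet. -/
theorem idem_mul_le {x y : R} (hx : x * x = x) (hy : y * y = y) : x * y ≤ x := by
  set m := meet x y with hm
  have hxm : x * m = meet x (x * y) := by rw [hm, mul_meet, hx]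
  have hym : y * m = meet (x * y) y := by rw [hm, mul_meet, hy, mul_comm y x]
  have hmm : m * m = meet (m * x) (m * y) := by conv_lhs => rw [hm, mul_meet, ← hm]
  have hle : m * m ≤ m := by
    apply le_meet
    · rw [hmm]
      refine (meet_le_left _ _).trans ?_
      rw [mul_comm, hxm]; exact meet_le_left _ _
    · rw [hmm]
      refine (meet_le_right _ _).trans ?_
      rw [mul_comm, hym]; exact meet_le_right _ _
  have hle2 : m * m ≤ x * y := by
    rw [hmm]
    refine (meet_le_left _ _).trans ?_
    rw [mul_comm, hxm]; exact meet_le_right _ _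
  have hxe : eps ≤ x := IsDirected.eps_le x hx
  have hye : eps ≤ y := IsDirected.eps_le y hy
  have hvm : v m = eps := by
    apply le_antisymm
    · have := v_le (meet_le_left x y); rwa [v_of_mul_idem hx] at this
    · have := v_le (le_meet hxe hye); rwa [v_of_idem eps_add] at this
  have hmi : m * m = m := by
    apply eq_of_le hle
    rw [ep_mul, hvm, eps_mul_idem (ep_idem m), ep_idem]
  rw [hmi] at hle2
  have h3 : x * y * m = x * y := by
    calc x * y * m = x * (y * m) := mul_assoc _ _ _
      _ = meet (x * (x * y)) (x * y) := by rw [hym, mul_meet]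
      _ = meet (x * y) (x * y) := by rw [← mul_assoc, hx]
      _ = x * y := le_antisymm (meet_le_left _ _) (le_meet le_rfl le_rfl)
  have hxy : x * y * (x * y) = x * y := by
    calc x * y * (x * y) = (x * x) * (y * y) := by ac_rfl
      _ = _ := by rw [hx, hy]
  have h4 : ep (x * y) ≤ ep m := by
    rw [← h3, ep_mul_of_mul_idem hxy hmi, add_comm]
    exact add_idem_le _ (ep_idem _)
  rw [← eq_of_le hle2 h4]
  exact meet_le_left _ _

theorem idem_le_idem {x y : R} (hx : x * x = x) (hy : y * y = y) (h : ep x ≤ ep y) : x ≤ y := by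
  have h1 : x * y = x := by
    apply eq_of_le (idem_mul_le hx hy)
    rw [ep_mul_of_mul_idem hx hy, add_of_le (ep_idem x) h]
  rw [← h1, mul_comm]
  exact idem_mul_le hy hx

theorem mul_idem_le (x : R) {y : R} (hy : y * y = y) : x * y ≤ x := by
  have h := mul_le x (idem_mul_le (eb_idem x) hy)
  rwa [← mul_assoc, mul_eb] at h

end Directed

/-- The carrier of `B(R)`: the inverse limit of the groups `R_α = {x | e⁺(x) = α}`, `α ∈ Λ₊`,
as the set of monotone sections over `Λ₊` of `e⁺`. -/
@[ext]
structure LimRing (R : Type*) [CRQSring R] where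
  toFun : LamPos R → R
  ep_toFun : ∀ α, ep (toFun α) = α
  mono : ∀ α β, α ≤ β → toFun α ≤ toFun β

namespace LimRing

variable {R : Type*} [CRQSring R]

instance : CoeFun (LimRing R) fun _ => LamPos R → R := ⟨toFun⟩

/-- `ε` as an element of `Λ₊`. -/
def e0 : LamPos R := ⟨eps, eps_add, le_rfl⟩

theorem v_e0_le (φ : LimRing R) : v (φ e0) ≤ eps := by
  have := v_le_ep (φ e0)
  rwa [φ.ep_toFun] at this

theorem eps_le_mul {f g : R} (hf : eps ≤ f) (hg : eps ≤ g) : eps ≤ f * g := by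
  have := mul_le' hf hg
  rwa [eps_mul] at this

/-- `α • v(φ(ε))⁻¹`, an element of `Λ₊`. -/
def shift (φ : LimRing R) (α : LamPos R) : LamPos R :=
  ⟨(α : R) * (v (φ e0))⁻¹, by
    refine ⟨mul_idem_mul _ (inv_add_idem (v_idem _)), eps_le_mul α.2.2 ?_⟩
    have h := mul_le (v (φ e0))⁻¹ (v_e0_le φ)
    rwa [mul_comm, eb_of_idem (v_idem _), mul_comm,
      eps_mul_idem (inv_add_idem (v_idem _))] at h⟩

/-- Multiplication on `Λ₊`. -/
def pmul (α β : LamPos R) : LamPos R :=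
  ⟨(α : R) * β, mul_idem_mul _ β.2.1, eps_le_mul α.2.2 β.2.2⟩

theorem le_pmul_left (α β : LamPos R) : α ≤ pmul α β := by
  have h := mul_le (α : R) β.2.2
  rw [mul_comm, eps_mul_idem α.2.1] at h
  exact h

theorem le_pmul_right (α β : LamPos R) : β ≤ pmul α β := by
  have h := mul_le (β : R) α.2.2
  rw [mul_comm, eps_mul_idem β.2.1, mul_comm] at h
  exact h

theorem e0_le (α : LamPos R) : (e0 : LamPos R) ≤ α := α.2.2

theorem add_eq {φ : LimRing R} {α β : LamPos R} (h : α ≤ β) : φ β + (α : R) = φ α := by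
  have := le_def.1 (φ.mono α β h)
  rw [φ.ep_toFun] at this
  exact this.symm

/-- The defining formula for the product is a lower bound with `e⁺ ≥ α`. -/
theorem le_ep_mul (φ ψ : LimRing R) (α γ δ : LamPos R) (hγ : shift ψ α ≤ γ) (hδ : shift φ α ≤ δ) :
    (α : R) ≤ ep (φ γ * ψ δ) := by
  have key : ∀ (φ ψ : LimRing R) (γ δ : LamPos R), shift φ α ≤ δ → (α : R) ≤ v (φ γ) * δ := by
    intro φ ψ γ δ h
    have h1 : v (φ e0) ≤ v (φ γ) := v_le (φ.mono _ _ (e0_le γ))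
    have h2 : (α : R) * (v (φ e0))⁻¹ ≤ δ := h
    refine le_trans (le_of_eq ?_) (mul_le' h1 h2)
    calc (α : R) = eps * α := (eps_mul_idem α.2.1).symm
      _ = v (φ e0) * (v (φ e0))⁻¹ * α := by rw [eb_of_idem (v_idem _)]
      _ = _ := by ac_rfl
  rw [ep_mul, ψ.ep_toFun, φ.ep_toFun]
  exact le_add α.2.1 (key φ ψ γ δ hδ) (key ψ φ δ γ hγ)

theorem ep_add_of_le {x : R} {α : LamPos R} (h : (α : R) ≤ ep x) : ep (x + α) = α := by
  rw [ep_add, ep_of_idem α.2.1, add_comm]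
  exact add_of_le α.2.1 h

/-- The product `(φψ)(α) = φ(α • v(ψ(ε))⁻¹) • ψ(α • v(φ(ε))⁻¹) + α`. -/
def mulFun (φ ψ : LimRing R) (α : LamPos R) : R :=
  φ (shift ψ α) * ψ (shift φ α) + α

theorem ep_mulFun (φ ψ : LimRing R) (α : LamPos R) : ep (mulFun φ ψ α) = α :=
  ep_add_of_le (le_ep_mul φ ψ α _ _ le_rfl le_rfl)

theorem eq_of_le_add {x y : R} {α : LamPos R} (hx : ep x = α) (h : x ≤ y + α) : x = y + α := by
  apply eq_of_le h
  rw [ep_add, ep_of_idem α.2.1, hx, add_comm]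
  exact add_idem_le _ (ep_idem y)

/-- The product as a limit. -/
theorem mulFun_eq (φ ψ : LimRing R) (α γ δ : LamPos R) (hγ : shift ψ α ≤ γ)
    (hδ : shift φ α ≤ δ) : mulFun φ ψ α = φ γ * ψ δ + α :=
  eq_of_le_add (ep_mulFun φ ψ α) (add_mono (mul_le' (φ.mono _ _ hγ) (ψ.mono _ _ hδ)) _)

theorem exists_large (φ ψ : LimRing R) (α : LamPos R) :
    ∃ γ, ∀ δ, γ ≤ δ → mulFun φ ψ α = φ δ * ψ δ + α :=
  ⟨pmul (shift ψ α) (shift φ α), fun δ h =>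
    mulFun_eq φ ψ α δ δ ((le_pmul_left _ _).trans h) ((le_pmul_right _ _).trans h)⟩

instance : Zero (LimRing R) := ⟨⟨fun α => α, fun α => ep_of_idem α.2.1, fun _ _ h => h⟩⟩

instance : Add (LimRing R) :=
  ⟨fun φ ψ => ⟨fun α => φ α + ψ α,
    fun α => by rw [ep_add, φ.ep_toFun, ψ.ep_toFun, α.2.1],
    fun α β h => add_mono' (φ.mono α β h) (ψ.mono α β h)⟩⟩

instance : Neg (LimRing R) :=
  ⟨fun φ => ⟨fun α => -φ α, fun α => by rw [ep_neg, φ.ep_toFun],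
    fun α β h => neg_le (φ.mono α β h)⟩⟩

instance : Mul (LimRing R) :=
  ⟨fun φ ψ => ⟨mulFun φ ψ, ep_mulFun φ ψ, fun α β h => by
    obtain ⟨γ, hγ⟩ := exists_large φ ψ α
    obtain ⟨δ, hδ⟩ := exists_large φ ψ β
    rw [hγ (pmul γ δ) (le_pmul_left _ _), hδ (pmul γ δ) (le_pmul_right _ _)]
    rw [add_comm _ (α : R), add_comm _ (β : R)]
    exact add_mono h _⟩⟩

theorem zero_apply (α : LamPos R) : (0 : LimRing R) α = α := rfl
theorem add_apply (φ ψ : LimRing R) (α : LamPos R) : (φ + ψ) α = φ α + ψ α := rfl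
theorem neg_apply (φ : LimRing R) (α : LamPos R) : (-φ) α = -φ α := rfl
theorem mul_apply (φ ψ : LimRing R) (α : LamPos R) :
    (φ * ψ) α = φ (shift ψ α) * ψ (shift φ α) + α := rfl

theorem mul_large (φ ψ : LimRing R) (α : LamPos R) :
    ∃ γ, ∀ δ, γ ≤ δ → (φ * ψ) α = φ δ * ψ δ + α := exists_large φ ψ α

protected theorem mul_comm' (φ ψ : LimRing R) : φ * ψ = ψ * φ := by
  ext α; rw [mul_apply, mul_apply, mul_comm]

theorem mul_mul_large (φ ψ χ : LimRing R) (α : LamPos R) :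
    ∃ γ, ∀ δ, γ ≤ δ → ((φ * ψ) * χ) α = φ δ * ψ δ * χ δ + α := by
  obtain ⟨γ, hγ⟩ := mul_large (φ * ψ) χ α
  obtain ⟨γ', hγ'⟩ := mul_large φ ψ γ
  refine ⟨pmul γ γ', fun δ h => ?_⟩
  have h1 : γ ≤ δ := (le_pmul_left _ _).trans h
  have h2 : γ' ≤ δ := (le_pmul_right _ _).trans h
  apply eq_of_le_add (((φ * ψ) * χ).ep_toFun α)
  rw [hγ γ le_rfl]
  refine add_mono (mul_le' ?_ (χ.mono _ _ h1)) _
  rw [hγ' δ h2]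
  exact add_idem_le _ γ.2.1

protected theorem mul_assoc' (φ ψ χ : LimRing R) : φ * ψ * χ = φ * (ψ * χ) := by
  ext α
  obtain ⟨γ, hγ⟩ := mul_mul_large φ ψ χ α
  obtain ⟨δ, hδ⟩ := mul_mul_large ψ χ φ α
  rw [LimRing.mul_comm' φ (ψ * χ), hγ (pmul γ δ) (le_pmul_left _ _),
    hδ (pmul γ δ) (le_pmul_right _ _)]
  congr 1
  ac_rfl

protected theorem mul_add' (φ ψ χ : LimRing R) : φ * (ψ + χ) = φ * ψ + φ * χ := by
  ext α
  obtain ⟨γ, hγ⟩ := mul_large φ (ψ + χ) α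
  obtain ⟨δ, hδ⟩ := mul_large φ ψ α
  obtain ⟨ζ, hζ⟩ := mul_large φ χ α
  let μ := pmul γ (pmul δ ζ)
  have h1 : γ ≤ μ := le_pmul_left _ _
  have h2 : δ ≤ μ := (le_pmul_left δ ζ).trans (le_pmul_right _ _)
  have h3 : ζ ≤ μ := (le_pmul_right δ ζ).trans (le_pmul_right _ _)
  symm
  rw [hγ μ h1]
  apply eq_of_le_add ((φ * ψ + φ * χ).ep_toFun α)
  rw [add_apply, hδ μ h2, hζ μ h3, add_apply]
  have e : φ μ * ψ μ + (α : R) + (φ μ * χ μ + α) = (φ μ * ψ μ + φ μ * χ μ) + α := by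
    calc _ = (φ μ * ψ μ + φ μ * χ μ) + ((α : R) + α) := by ac_rfl
      _ = _ := by rw [α.2.1]
  rw [e]
  exact add_mono (quasi_distrib _ _ _) _

section Unital

variable [IsSuperrigid R]

/-- The element `1_α`: the idempotent `x ∈ E•` with `e⁺(x) = α`. -/
noncomputable def oneAt (α : LamPos R) : R := (IsSuperrigid.exists_idem α).choose

theorem oneAt_idem (α : LamPos R) : oneAt α * oneAt α = oneAt α :=
  (IsSuperrigid.exists_idem α).choose_spec.1

theorem ep_oneAt (α : LamPos R) : ep (oneAt α) = α :=
  (IsSuperrigid.exists_idem α).choose_spec.2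

/-- `1_α` is the only element of `E•` with `e⁺ = α`. -/
theorem oneAt_unique {α : LamPos R} {x : R} (hx : x * x = x) (h : ep x = α) : x = oneAt α :=
  le_antisymm (idem_le_idem hx (oneAt_idem α) (by rw [h, ep_oneAt]))
    (idem_le_idem (oneAt_idem α) hx (by rw [h, ep_oneAt]))

noncomputable instance : One (LimRing R) :=
  ⟨⟨oneAt, ep_oneAt, fun α β h => idem_le_idem (oneAt_idem α) (oneAt_idem β)
    (by rw [ep_oneAt, ep_oneAt]; exact h)⟩⟩

theorem one_apply (α : LamPos R) : (1 : LimRing R) α = oneAt α := rfl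

protected theorem mul_one' (φ : LimRing R) : φ * 1 = φ := by
  ext α
  obtain ⟨γ, hγ⟩ := mul_large φ 1 α
  have h1 : γ ≤ pmul γ α := le_pmul_left _ _
  have h2 : α ≤ pmul γ α := le_pmul_right _ _
  refine Eq.trans ?_ (add_eq (φ := φ) h2)
  apply eq_of_le_add ((φ * 1).ep_toFun α)
  rw [hγ _ h1]
  exact add_mono (mul_idem_le _ (oneAt_idem _)) _

/-- The commutative ring `B(R)` associated to a superrigid directed cr-qsring `R`. -/
noncomputable instance : CommRing (LimRing R) where
  add_assoc φ ψ χ := by ext α; exact add_assoc _ _ _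
  zero_add φ := by
    ext α; rw [add_apply, zero_apply, ← φ.ep_toFun α, ep_add_self]
  add_zero φ := by
    ext α; rw [add_apply, zero_apply, ← φ.ep_toFun α, add_ep_self]
  add_comm φ ψ := by ext α; exact add_comm _ _
  neg_add_cancel φ := by
    ext α; rw [add_apply, neg_apply, zero_apply, add_comm]; exact φ.ep_toFun α
  nsmul := nsmulRec
  zsmul := zsmulRec
  mul_assoc := LimRing.mul_assoc'
  mul_comm := LimRing.mul_comm'
  one_mul φ := by rw [LimRing.mul_comm']; exact LimRing.mul_one' φ
  mul_one := LimRing.mul_one'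
  left_distrib := LimRing.mul_add'
  right_distrib φ ψ χ := by
    rw [LimRing.mul_comm', LimRing.mul_add', LimRing.mul_comm' χ φ, LimRing.mul_comm' χ ψ]
  zero_mul φ := by
    ext α
    have h : ∀ γ δ : LamPos R, ((0 : LimRing R) γ * φ δ) + ((0 : LimRing R) γ * φ δ) =
        (0 : LimRing R) γ * φ δ := by
      intro γ δ; rw [zero_apply, mul_comm]; exact mul_idem_mul _ γ.2.1
    have h2 := (0 * φ).ep_toFun α
    rw [mul_apply, ep_of_idem (idem_add (h _ _) α.2.1)] at h2
    rw [mul_apply, h2, zero_apply]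
  mul_zero φ := by
    rw [LimRing.mul_comm']
    ext α
    have h : ∀ γ δ : LamPos R, ((0 : LimRing R) γ * φ δ) + ((0 : LimRing R) γ * φ δ) =
        (0 : LimRing R) γ * φ δ := by
      intro γ δ; rw [zero_apply, mul_comm]; exact mul_idem_mul _ γ.2.1
    have h2 := (0 * φ).ep_toFun α
    rw [mul_apply, ep_of_idem (idem_add (h _ _) α.2.1)] at h2
    rw [mul_apply, h2, zero_apply]

end Unital

/-- The `l`-valuation `w(φ) = v ∘ φ : Λ₊ → Λ`. -/
def w (φ : LimRing R) (α : LamPos R) : Lam R := ⟨v (φ α), v_idem _⟩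

section ValuationRing

variable [IsSuperrigid R]

/-- The `l`-valuation ring `A = {φ ∈ B(R) | w(φ) ≥ ε}`. -/
noncomputable def valRing (R : Type*) [CRQSring R] [IsSuperrigid R] : Subring (LimRing R) where
  carrier := {φ | ∀ α, eps ≤ (w φ α : R)}
  mul_mem' {φ ψ} hφ hψ α := by
    obtain ⟨γ, hγ⟩ := mul_large φ ψ α
    change eps ≤ v ((φ * ψ) α)
    rw [hγ γ le_rfl]
    refine le_trans ?_ (v_add _ _)
    rw [v_mul, v_of_idem α.2.1]
    exact le_add eps_add (eps_le_mul (hφ γ) (hψ γ)) α.2.2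
  one_mem' α := by
    change eps ≤ v (oneAt α)
    rw [v_of_mul_idem (oneAt_idem α)]
  add_mem' {φ ψ} hφ hψ α := (le_add eps_add (hφ α) (hψ α)).trans (v_add _ _)
  zero_mem' α := by
    change eps ≤ v (α : R)
    rw [v_of_idem α.2.1]; exact α.2.2
  neg_mem' {φ} hφ α := by
    change eps ≤ v (-φ α)
    rw [v_neg]; exact hφ α

/-- `A = {φ ∈ B(R) | φ(ε) = ε}`. -/
theorem mem_valRing_iff (φ : LimRing R) : φ ∈ valRing R ↔ φ e0 = eps := by
  constructor
  · intro h
    have h1 : (eps : R) ≤ φ e0 := (h e0).trans (v_le_self _)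
    exact (eq_of_le h1 (by rw [φ.ep_toFun, ep_of_idem eps_add]; exact le_rfl)).symm
  · intro h α
    have h1 := v_le (φ.mono _ _ (e0_le α))
    rwa [h, v_of_idem eps_add] at h1

end ValuationRing

end LimRing

end CRQSring

/-- For a subring `A` of a commutative ring `B`: the `B`-invertible `A`-submodules of `B`, i.e.
those `I` with `I J = A` for some `A`-submodule `J` of `B`. -/
def invertibleSubmodules {B : Type*} [CommRing B] (A : Subring B) : Set (Submodule A B) :=
  {I | ∃ J : Submodule A B, I * J = 1}

/-- The finitely generated `B`-regular `A`-submodules of `B`, i.e. those with `I B = B`. -/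
def regularFGSubmodules {B : Type*} [CommRing B] (A : Subring B) : Set (Submodule A B) :=
  {I | I.FG ∧ Ideal.span (I : Set B) = ⊤}

/-- `A ⊆ B` is a Prüfer extension: the invertible `A`-submodules of `B` are exactly the finitely
generated `B`-regular ones. -/
def IsPruferExtension {B : Type*} [CommRing B] (A : Subring B) : Prop :=
  invertibleSubmodules A = regularFGSubmodules A

/-!
`Λ` is an Abelian lattice-ordered group with meet `+`, and the elements of `B` of value at least
`f ∈ Λ` form an `A`-submodule `level f` of `B`. If `x ∈ R` is a truncation of `φ ∈ B`, then
spherical completeness lifts `x⁻¹` to an element of `B` that inverts `φ` up to an error of value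
`e⁺(x) • v(x)⁻¹`, by superrigidity. For suitable truncations of `1` this gives
`level (f ⊓ g) = level f ⊔ level g`. Hence a finitely generated `I` agrees, up to errors of
arbitrarily large value, with `level m`, where `m` is the meet of the values of truncations of its
generators; if moreover `I B = B`, then `1 ∈ I * level f` for some `f`, so that `I` absorbs the
error, and `I * level m⁻¹ = A`.
-/

namespace CRQSring

open Filter

section LatticeOrderedGroup

variable {R : Type*} [CRQSring R]

/-- `Λ` as an Abelian group under `•`, with neutral element `ε`. -/
instance : CommGroup (Lam R) where
  mul f g := ⟨f * g, mul_idem_mul _ g.2⟩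
  one := ⟨eps, eps_add⟩
  inv f := ⟨(f : R)⁻¹, inv_add_idem f.2⟩
  mul_assoc _ _ _ := Subtype.ext (mul_assoc _ _ _)
  mul_comm _ _ := Subtype.ext (mul_comm _ _)
  one_mul f := Subtype.ext (eps_mul_idem f.2)
  mul_one f := Subtype.ext ((mul_comm _ _).trans (eps_mul_idem f.2))
  inv_mul_cancel f := Subtype.ext ((mul_comm _ _).trans (eb_of_idem f.2))

/-- Meets for the canonical order on `Λ`: they are given by `+`. -/
instance : SemilatticeInf (Lam R) where
  inf f g := ⟨f + g, idem_add f.2 g.2⟩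
  inf_le_left f g := add_idem_le (f : R) g.2
  inf_le_right f g := (add_comm (f : R) g).trans_le (add_idem_le (g : R) f.2)
  le_inf f _ _ := le_add f.2

instance : IsOrderedMonoid (Lam R) where
  mul_le_mul_left _ _ h f := mul_le' (R := R) h (le_refl (f : R))

/-- The lattice structure of the `l`-group `Λ`; inversion turns meets into joins. -/
instance : Lattice (Lam R) where
  sup f g := (f⁻¹ ⊓ g⁻¹)⁻¹
  le_sup_left _ _ := le_inv'.2 inf_le_left
  le_sup_right _ _ := le_inv'.2 inf_le_right
  sup_le _ _ _ hf hg := inv_le'.2 (le_inf (inv_le_inv' hf) (inv_le_inv' hg))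

/-- The quasivaluation `v` as a map to the lattice-ordered group `Λ`. -/
def vLam (x : R) : Lam R := ⟨v x, v_idem x⟩

/-- The map `e⁺` as a map to the lattice-ordered group `Λ`. -/
def epLam (x : R) : Lam R := ⟨ep x, ep_idem x⟩

theorem vLam_mono : Monotone (vLam : R → Lam R) := fun _ _ => v_le

theorem vLam_mul (x y : R) : vLam (x * y) = vLam x * vLam y := Subtype.ext (v_mul x y)

theorem vLam_inv (x : R) : vLam x⁻¹ = (vLam x)⁻¹ := Subtype.ext (v_inv x).symm

theorem vLam_coe (f : Lam R) : vLam (f : R) = f := Subtype.ext (v_of_idem f.2)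

theorem vLam_of_mul_idem {x : R} (hx : x * x = x) : vLam x = 1 := Subtype.ext (v_of_mul_idem hx)

theorem inf_le_vLam_add (x y : R) : vLam x ⊓ vLam y ≤ vLam (x + y) := v_add x y

theorem vLam_le_epLam (x : R) : vLam x ≤ epLam x := v_le_ep x

theorem epLam_add_coe (x : R) (f : Lam R) : epLam (x + f) = epLam x ⊓ f :=
  Subtype.ext ((ep_add x f).trans (congrArg (ep x + ·) (ep_of_idem f.2)))

theorem vLam_add_coe (x : R) (f : Lam R) : vLam (x + f) = vLam x ⊓ f := by
  refine le_antisymm (le_inf (vLam_mono (add_idem_le x f.2)) ?_) ?_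
  · calc vLam (x + f) ≤ epLam (x + f) := vLam_le_epLam _
      _ ≤ f := (epLam_add_coe x f).trans_le inf_le_right
  · simpa only [vLam_coe] using inf_le_vLam_add x (f : R)

theorem epLam_eb (x : R) : epLam (eb x) = epLam x / vLam x :=
  eq_div_of_mul_eq' ((mul_comm _ _).trans (Subtype.ext (ep_eq x).symm))

/-- The inclusion of `Λ₊` in the lattice-ordered group `Λ`. -/
def LamPos.toLam (α : LamPos R) : Lam R := ⟨α, α.2.1⟩

instance : Nonempty (LamPos R) := ⟨LimRing.e0⟩

instance : IsDirectedOrder (LamPos R) :=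
  ⟨fun α β => ⟨LimRing.pmul α β, LimRing.le_pmul_left α β, LimRing.le_pmul_right α β⟩⟩

theorem eventually_le_toLam (f : Lam R) : ∀ᶠ α : LamPos R in atTop, f ≤ α.toLam := by
  let β : LamPos R := ⟨(f ⊔ 1 : Lam R), (f ⊔ 1).2, (le_sup_right : 1 ≤ f ⊔ 1)⟩
  filter_upwards [eventually_ge_atTop β] with α hα
  exact (le_sup_left : f ≤ f ⊔ 1).trans hα

end LatticeOrderedGroup

section Superrigid

variable {R : Type*} [CRQSring R] [IsSuperrigid R]

open LimRing

theorem exists_oneAt_eq_eb (x : R) :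
    ∃ α : LamPos R, α.toLam = epLam x / vLam x ∧ oneAt α = eb x := by
  have hpos : 1 ≤ epLam x / vLam x := one_le_div'.2 (vLam_le_epLam x)
  let α : LamPos R := ⟨(epLam x / vLam x : Lam R), (epLam x / vLam x).2, hpos⟩
  have hα : ep (eb x) = α := congrArg Subtype.val (epLam_eb x)
  exact ⟨α, rfl, (oneAt_unique (eb_idem x) hα).symm⟩

theorem toLam_le_vLam_sub {α : LamPos R} {x y : R} (hx : oneAt α ≤ x) (hy : oneAt α ≤ y) :
    α.toLam ≤ vLam (x + -y) := by
  have h : (α : R) ≤ x + -y := ep_oneAt α ▸ add_mono' hx (neg_le hy)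
  exact (vLam_coe α.toLam).symm.trans_le (vLam_mono h)

end Superrigid

namespace LimRing

variable {R : Type*} [CRQSring R]

theorem eventually_mul_apply (φ ψ : LimRing R) (α : LamPos R) :
    ∀ᶠ δ in atTop, (φ * ψ) α = φ δ * ψ δ + α :=
  eventually_atTop.2 (mul_large φ ψ α)

theorem w_mono (φ : LimRing R) : Monotone (w φ) := fun _ _ h => vLam_mono (φ.mono _ _ h)

theorem inf_le_w_add (φ ψ : LimRing R) (α : LamPos R) : w φ α ⊓ w ψ α ≤ w (φ + ψ) α :=
  inf_le_vLam_add _ _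

theorem w_zero (α : LamPos R) : w 0 α = α.toLam := vLam_coe α.toLam

theorem w_eq_inf_of_le (φ : LimRing R) {α β : LamPos R} (h : α ≤ β) :
    w φ α = w φ β ⊓ α.toLam :=
  (congrArg vLam (add_eq h).symm).trans (vLam_add_coe _ α.toLam)

theorem eventually_w_mul (φ ψ : LimRing R) (α : LamPos R) :
    ∀ᶠ δ in atTop, w (φ * ψ) α = w φ δ * w ψ δ ⊓ α.toLam := by
  filter_upwards [eventually_mul_apply φ ψ α] with δ hδ
  calc w (φ * ψ) α = vLam (φ δ * ψ δ + α) := congrArg vLam hδ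
    _ = vLam (φ δ * ψ δ) ⊓ α.toLam := vLam_add_coe _ α.toLam
    _ = w φ δ * w ψ δ ⊓ α.toLam := by rw [vLam_mul]; rfl

theorem eventually_mul_le_w_mul {φ ψ : LimRing R} {f g : Lam R}
    (hφ : ∀ᶠ δ in atTop, f ≤ w φ δ) (hψ : ∀ᶠ δ in atTop, g ≤ w ψ δ) :
    ∀ᶠ δ in atTop, f * g ≤ w (φ * ψ) δ := by
  filter_upwards [eventually_le_toLam (f * g)] with α hα
  obtain ⟨δ, hδ, hφδ, hψδ⟩ := ((eventually_w_mul φ ψ α).and (hφ.and hψ)).exists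
  exact hδ ▸ le_inf (mul_le_mul' hφδ hψδ) hα

theorem exists_eventually_le (hc : IsSphericallyComplete R) (x : R) :
    ∃ ψ : LimRing R, ∀ᶠ δ in atTop, x ≤ ψ δ := by
  obtain ⟨φ, hep, hmono, hx⟩ := hc x
  refine ⟨⟨fun α => φ α.toLam, fun α => hep _, fun α β h => hmono _ _ h⟩, ?_⟩
  filter_upwards [eventually_le_toLam (epLam x)] with δ hδ
  exact hx.symm.trans_le (hmono _ _ hδ)

variable [IsSuperrigid R]

/-- The `A`-submodule of `B` of the elements of value at least `f`. As `w(φ)(δ)` never exceeds `δ`,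
the bound `f ≤ w(φ)(δ)` is only imposed for large `δ`. -/
noncomputable def level (f : Lam R) : Submodule (valRing R) (LimRing R) where
  carrier := {φ | ∀ᶠ δ in atTop, f ≤ w φ δ}
  zero_mem' := (eventually_le_toLam f).mono fun δ hδ => hδ.trans_eq (w_zero δ).symm
  add_mem' {φ ψ} hφ hψ := by
    filter_upwards [hφ, hψ] with δ hφδ hψδ
    exact (le_inf hφδ hψδ).trans (inf_le_w_add φ ψ δ)
  smul_mem' a φ hφ := by
    have ha : ∀ᶠ δ in atTop, 1 ≤ w (a : LimRing R) δ := .of_forall a.2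
    exact one_mul f ▸ eventually_mul_le_w_mul ha hφ

theorem mem_level_of_le {f : Lam R} {φ : LimRing R} {δ : LamPos R} (h : f ≤ w φ δ) :
    φ ∈ level f := by
  filter_upwards [eventually_ge_atTop δ] with α hα
  exact h.trans (w_mono φ hα)

theorem level_anti : Antitone (level : Lam R → Submodule (valRing R) (LimRing R)) :=
  fun _ _ h _ hφ => hφ.mono fun _ => h.trans

theorem mul_mem_level {f g : Lam R} {φ ψ : LimRing R} (hφ : φ ∈ level f) (hψ : ψ ∈ level g) :
    φ * ψ ∈ level (f * g) :=
  eventually_mul_le_w_mul hφ hψ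

theorem level_mul_level_le (f g : Lam R) : level f * level g ≤ level (f * g) :=
  Submodule.mul_le.2 fun _ hφ _ hψ => mul_mem_level hφ hψ

theorem mem_level_one {φ : LimRing R} : φ ∈ level 1 ↔ φ ∈ valRing R := by
  refine ⟨fun hφ α => ?_, fun hφ => .of_forall hφ⟩
  obtain ⟨δ, hδ, hαδ⟩ := (hφ.and (eventually_ge_atTop α)).exists
  exact (le_inf hδ α.2.2).trans_eq (w_eq_inf_of_le φ hαδ).symm

theorem level_one : level (1 : Lam R) = 1 := by
  ext φ
  rw [mem_level_one, Submodule.mem_one]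
  exact ⟨fun hφ => ⟨⟨φ, hφ⟩, rfl⟩, fun ⟨a, ha⟩ => ha ▸ a.2⟩

section SphericallyComplete

variable (hc : IsSphericallyComplete R)
include hc

theorem exists_one_sub_mul_mem_level {φ : LimRing R} {δ : LamPos R} {x : R} (hx : x ≤ φ δ) :
    ∃ ψ ∈ level (vLam x)⁻¹, 1 - φ * ψ ∈ level (epLam x / vLam x) := by
  obtain ⟨ψ, hψ⟩ := exists_eventually_le hc x⁻¹
  obtain ⟨α, hα, hone⟩ := exists_oneAt_eq_eb x
  refine ⟨ψ, hψ.mono fun γ hγ => (vLam_inv x).symm.trans_le (vLam_mono hγ), ?_⟩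
  have hφψ : oneAt α ≤ (φ * ψ) α := by
    obtain ⟨γ, hγ, hδγ, hψγ⟩ :=
      ((eventually_mul_apply φ ψ α).and ((eventually_ge_atTop δ).and hψ)).exists
    calc oneAt α = oneAt α + α := by rw [← ep_oneAt α, add_ep_self]
      _ = x * x⁻¹ + α := by rw [hone, eb]
      _ ≤ φ γ * ψ γ + α := add_mono (mul_le' (hx.trans (φ.mono _ _ hδγ)) hψγ) _
      _ = (φ * ψ) α := hγ.symm
  rw [← hα, sub_eq_add_neg]
  exact mem_level_of_le (toLam_le_vLam_sub le_rfl hφψ)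

theorem exists_mem_level_one_sub_mem_level (f g : Lam R) :
    ∃ ψ ∈ level (g / (f ⊓ g)), 1 - ψ ∈ level (f / (f ⊓ g)) := by
  have hpos : 1 ≤ f / (f ⊓ g) := one_le_div'.2 inf_le_left
  let α : LamPos R := ⟨(f / (f ⊓ g) : Lam R), (f / (f ⊓ g)).2, hpos⟩
  let x : R := oneAt α + (f / g : Lam R)
  have hv : vLam x = (f ⊓ g) / g := by
    rw [vLam_add_coe, vLam_of_mul_idem (oneAt_idem α), inf_comm f, inf_div, div_self']
  have hep : epLam x = f / g := by
    have hα : epLam (oneAt α) = f / (f ⊓ g) := Subtype.ext (ep_oneAt α)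
    rw [epLam_add_coe, hα, inf_eq_right]
    exact div_le_div_left' inf_le_right f
  obtain ⟨ψ, hψ, hone⟩ := exists_one_sub_mul_mem_level hc
    (φ := 1) (δ := α) (x := x) (add_idem_le (oneAt α) (f / g).2)
  rw [hv, inv_div] at hψ
  rw [one_mul, hep, hv, div_div_div_cancel_right] at hone
  exact ⟨ψ, hψ, hone⟩

theorem level_inf (f g : Lam R) : level (f ⊓ g) = level f ⊔ level g := by
  refine le_antisymm (fun φ hφ => ?_) (sup_le (level_anti inf_le_left) (level_anti inf_le_right))
  obtain ⟨ψ, hg, hf⟩ := exists_mem_level_one_sub_mem_level hc f g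
  have hsplit : φ = (1 - ψ) * φ + ψ * φ := by ring
  rw [hsplit]
  refine Submodule.add_mem_sup ?_ ?_
  · simpa only [div_mul_cancel] using mul_mem_level hf hφ
  · simpa only [div_mul_cancel] using mul_mem_level hg hφ

theorem level_w_mul_le (φ : LimRing R) (δ : LamPos R) (t : Lam R) :
    level (w φ δ * t) ≤ Submodule.span (valRing R) {φ} * level t ⊔ level (δ.toLam * t) := by
  intro χ hχ
  obtain ⟨ψ, hψ, hone⟩ := exists_one_sub_mul_mem_level hc (le_refl (φ δ))
  have hep : epLam (φ δ) = δ.toLam := Subtype.ext (φ.ep_toFun δ)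
  have hψχ : ψ * χ ∈ level t := by
    simpa only [inv_mul_cancel_left] using mul_mem_level (g := vLam (φ δ) * t) hψ hχ
  have herror : (1 - φ * ψ) * χ ∈ level (δ.toLam * t) := by
    simpa only [hep, div_mul_mul_cancel, ← mul_assoc, div_mul_cancel]
      using mul_mem_level (g := vLam (φ δ) * t) hone hχ
  have hsplit : χ = φ * (ψ * χ) + (1 - φ * ψ) * χ := by ring
  rw [hsplit]
  exact Submodule.add_mem_sup
    (Submodule.mul_mem_mul (Submodule.mem_span_singleton_self φ) hψχ) herror

theorem exists_le_level_level_mul_le {I : Submodule (valRing R) (LimRing R)} (hI : I.FG)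
    (δ : LamPos R) :
    ∃ m, I ≤ level m ∧ ∀ t, level (m * t) ≤ I * level t ⊔ level (δ.toLam * t) := by
  induction I, hI using Submodule.fg_induction with
  | singleton φ =>
    exact ⟨w φ δ, (Submodule.span_singleton_le_iff_mem _ _).2 (mem_level_of_le le_rfl),
      level_w_mul_le hc φ δ⟩
  | sup I J _ _ hI hJ =>
    obtain ⟨m, hIm, hm⟩ := hI
    obtain ⟨n, hJn, hn⟩ := hJ
    refine ⟨m ⊓ n, (sup_le_sup hIm hJn).trans_eq (level_inf hc m n).symm, fun t => ?_⟩
    rw [inf_mul, level_inf hc, Submodule.sup_mul, sup_sup_distrib_right]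
    exact sup_le_sup (hm t) (hn t)

end SphericallyComplete

theorem exists_mem_mul_level {I : Submodule (valRing R) (LimRing R)} {φ : LimRing R}
    (hφ : φ ∈ Ideal.span (I : Set (LimRing R))) : ∃ f, φ ∈ I * level f := by
  induction hφ using Submodule.span_induction with
  | mem φ hφ =>
    exact ⟨1, by rwa [level_one, mul_one]⟩
  | zero => exact ⟨1, zero_mem _⟩
  | add φ ψ _ _ hφ hψ =>
    obtain ⟨f, hf⟩ := hφ
    obtain ⟨g, hg⟩ := hψ
    exact ⟨f ⊓ g, add_mem (mul_le_mul_right (level_anti inf_le_left) I hf)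
      (mul_le_mul_right (level_anti inf_le_right) I hg)⟩
  | smul χ φ _ hφ =>
    obtain ⟨f, hf⟩ := hφ
    have hχ : χ ∈ level (w χ e0) := mem_level_of_le le_rfl
    have hmul : φ * χ ∈ I * (level f * level (w χ e0)) :=
      mul_assoc I _ _ ▸ Submodule.mul_mem_mul hf hχ
    rw [smul_eq_mul, mul_comm]
    exact ⟨f * w χ e0, mul_le_mul_right (level_mul_level_le _ _) I hmul⟩

theorem exists_level_mul_le_mul_level {I : Submodule (valRing R) (LimRing R)}
    (hI : Ideal.span (I : Set (LimRing R)) = ⊤) :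
    ∃ g, ∀ t, level (g * t) ≤ I * level t := by
  obtain ⟨f, hf⟩ := exists_mem_mul_level (hI ▸ Submodule.mem_top : (1 : LimRing R) ∈ _)
  refine ⟨f⁻¹, fun t => ?_⟩
  calc level (f⁻¹ * t) = 1 * level (f⁻¹ * t) := (one_mul _).symm
    _ ≤ I * level f * level (f⁻¹ * t) := mul_le_mul_left (Submodule.one_le.2 hf) _
    _ = I * (level f * level (f⁻¹ * t)) := mul_assoc _ _ _
    _ ≤ I * level (f * (f⁻¹ * t)) := mul_le_mul_right (level_mul_level_le _ _) I
    _ = I * level t := by rw [mul_inv_cancel_left]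

theorem exists_mul_eq_one (hc : IsSphericallyComplete R)
    {I : Submodule (valRing R) (LimRing R)} (hfg : I.FG)
    (hI : Ideal.span (I : Set (LimRing R)) = ⊤) :
    ∃ J : Submodule (valRing R) (LimRing R), I * J = 1 := by
  obtain ⟨g, hg⟩ := exists_level_mul_le_mul_level hI
  obtain ⟨δ, hδ⟩ := (eventually_le_toLam g).exists
  obtain ⟨m, hIm, hm⟩ := exists_le_level_level_mul_le hc hfg δ
  have hone : level (m * m⁻¹) = 1 := by rw [mul_inv_cancel, level_one]
  refine ⟨level m⁻¹, le_antisymm ?_ ?_⟩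
  · calc I * level m⁻¹ ≤ level m * level m⁻¹ := mul_le_mul_left hIm _
      _ ≤ level (m * m⁻¹) := level_mul_level_le m m⁻¹
      _ = 1 := hone
  · calc 1 = level (m * m⁻¹) := hone.symm
      _ ≤ I * level m⁻¹ ⊔ level (δ.toLam * m⁻¹) := hm m⁻¹
      _ ≤ I * level m⁻¹ ⊔ level (g * m⁻¹) :=
        sup_le_sup_left (level_anti (mul_le_mul_left hδ m⁻¹)) _
      _ ≤ I * level m⁻¹ := sup_le le_rfl (hg m⁻¹)

end LimRing

end CRQSring

theorem invertibleSubmodules_subset_regularFGSubmodules {B : Type*} [CommRing B]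
    (A : Subring B) : invertibleSubmodules A ⊆ regularFGSubmodules A := by
  rintro I ⟨J, hIJ⟩
  refine ⟨Submodule.fg_of_isUnit (IsUnit.of_mul_eq_one J hIJ), ?_⟩
  have hone : (1 : B) ∈ I * J := hIJ ▸ Submodule.one_le.1 le_rfl
  rw [Ideal.eq_top_iff_one]
  exact Submodule.mul_induction_on hone
    (fun x hx y _ => Ideal.mul_mem_right y _ (Ideal.subset_span hx)) fun _ _ => add_mem

theorem corollary6p9 (R : Type*) [CRQSring R] [CRQSring.IsSuperrigid R]
    (hc : CRQSring.IsSphericallyComplete R) :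
    IsPruferExtension (CRQSring.LimRing.valRing R) := by
  refine (invertibleSubmodules_subset_regularFGSubmodules _).antisymm ?_
  rintro I ⟨hfg, hI⟩
  exact CRQSring.LimRing.exists_mul_eq_one hc hfg hI
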